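/- For an open disk $D=D(c,\rho)=\{z\in\mathbb{C}:|z-c|<\rho\}$ let $\lambda_D(z)=\dfrac{\rho}{\rho^2-|z-c|^2}$ be its hyperbolic density (normalized to curvature $-4$). For a simply connected domain $\Omega\subsetneq\mathbb{C}$ and $z\in\Omega$, the Kulkarni--Pinkall density is $$\mu_\Omega(z)=\inf\{\lambda_D(z): D \text{ an open disk with } z\in D\subset\Omega\},$$ and the Kulkarni--Pinkall distance $\mathrm{KP}_\Omega(z,w)$ is the infimum of the lengths $\int_0^1\mu_\Omega(\gamma(t))\,|\gamma'(t)|\,dt$ over all $C^1$ curves $\gamma:[0,1]\to\Omega$ from $z$ to $w$. Let $0<r\le R$ and $d\ge 0$, and let $D_R$, $D_r$ be open disks in the plane of radii $R$ and $r$ whose centers are at distance $d$. Let $\mathcal{S}=\mathcal{S}(R,r,d)$ be the stadium they span, that is, the convex hull of $D_R\cup D_r$. If $r<R$, let $\theta=\arcsin\frac{R-r}{d}$ if $d\ge R-r$, and $\theta=\pi/2$ otherwise. Then the distance $\mathrm{KP}_{\mathcal{S}}$ between the centers of $D_R$ and $D_r$ is finite and equals $$\frac{d}{r}\quad\text{if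 } r=R,$$ and, when $r<R$, $$\frac12\log\frac{R+d}{R-d}\quad\text{if } d\le R\tan(\theta/2),$$ $$\frac12\left[\cot\frac{\theta}{2}\,\log\left(\frac{R}{r}\cos\theta\right)+\log\frac{1+\tan(\theta/2)}{1-\tan(\theta/2)}\right]\quad\text{if } d>R\tan(\theta/2).$$ -/

import Mathlib

open Set MeasureTheory
open scoped ENNReal

noncomputable section

/-- Density at `z` of the hyperbolic metric, of curvature `-4`, of the open disk with center `c`
and radius `ρ`. -/
def hypDiskDensity (c : ℂ) (ρ : ℝ) (z : ℂ) : ℝ :=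
  ρ / (ρ ^ 2 - dist z c ^ 2)

/-- Density of the Kulkarni-Pinkall metric of a domain `Ω` at a point `z` of `Ω`: the infimum of
the hyperbolic densities at `z` of the open disks `D` with `z ∈ D ⊆ Ω`. -/
def kpDensity (Ω : Set ℂ) (z : ℂ) : ℝ :=
  sInf {l : ℝ | ∃ (c : ℂ) (ρ : ℝ), z ∈ Metric.ball c ρ ∧ Metric.ball c ρ ⊆ Ω ∧
    l = hypDiskDensity c ρ z}

/-- `γ`, restricted to `[0, 1]`, is a continuously differentiable curve in `Ω` from `z` to `w`.
The velocity may vanish, so that every piecewise `C¹` curve has such a parametrization. -/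
structure IsCurveIn (Ω : Set ℂ) (z w : ℂ) (γ : ℝ → ℂ) : Prop where
  contDiffOn : ContDiffOn ℝ 1 γ (Icc 0 1)
  mapsTo : MapsTo γ (Icc 0 1) Ω
  source : γ 0 = z
  target : γ 1 = w

/-- Length of the curve `γ` on `[0, 1]` in the Kulkarni-Pinkall metric of `Ω`. -/
def kpLength (Ω : Set ℂ) (γ : ℝ → ℂ) : ℝ≥0∞ :=
  ∫⁻ t in Icc (0 : ℝ) 1,
    ENNReal.ofReal (kpDensity Ω (γ t) * ‖derivWithin γ (Icc 0 1) t‖)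

/-- Kulkarni-Pinkall distance, as an extended nonnegative real: the infimum of the lengths of the
curves in `Ω` from `z` to `w`. -/
def kpEDist (Ω : Set ℂ) (z w : ℂ) : ℝ≥0∞ :=
  ⨅ (γ : ℝ → ℂ) (_ : IsCurveIn Ω z w γ), kpLength Ω γ

/-- Kulkarni-Pinkall distance as a real number. -/
def kpDist (Ω : Set ℂ) (z w : ℂ) : ℝ :=
  (kpEDist Ω z w).toReal

/-- The stadium spanned by the open disks with centers `a`, `b` and radii `r₁`, `r₂`. -/
def stadium (a b : ℂ) (r₁ r₂ : ℝ) : Set ℂ :=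
  convexHull ℝ (Metric.ball a r₁ ∪ Metric.ball b r₂)

/-- The angle `θ` of a stadium with radii `r ≤ R` and distance `d` between the centers. -/
def stadiumAngle (R r d : ℝ) : ℝ :=
  if R - r ≤ d then Real.arcsin ((R - r) / d) else Real.pi / 2

end

/-! The density is compared with a radial one. For `r < R` let `P` be the apex of the sector of
half-angle `θ` around the stadium, at distance `A = R / sin θ` from the large center. If `θ = π /
2`, the sector is a half-plane and `P` lies on the boundary circle of `D_R`. A disk of center `c`
and radius `ρ` in the stadium satisfies `ρ ≤ R` and `ρ ≤ sin θ * ‖c - P‖`, while `|z - c|` is at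
least the difference of the distances of `z` and `c` to `P`. Maximizing `(ρ² - |z - c|²) / ρ` under
these constraints bounds the density below by a function `g` of `‖z - P‖` alone, with equality on
the segment of centers, where a disk centered on the axis is optimal (`sq_sub_sq_le_mul_axisRadius`,
`kpEDist_stadium_eq_integral`).

A curve between the centers is thus at least as long as its radial variation weighted by `g`, and
the segment, being radial, attains this bound (`kpEDist_eq_of_radial`). The distance is an integral
of `g`. For `r = R` the constant `g = 1 / R` suffices. -/

/-! ### Radial comparison of lengths -/

/-- A primitive of `g` evaluated at `‖γ t - P‖` changes at rate at most `g ‖γ t - P‖ * ‖γ' t‖`,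
because the norm is 1-Lipschitz. It is differentiable along `γ` because `γ` avoids `P`. -/
theorem integral_le_kpLength {Ω : Set ℂ} {a b P : ℂ} {g : ℝ → ℝ}
    (hg : ContinuousOn g (Ioi 0)) (hg0 : ∀ x, 0 < x → 0 ≤ g x)
    (hP : P ∉ Ω) (hkp : ∀ z ∈ Ω, g ‖z - P‖ ≤ kpDensity Ω z)
    {γ : ℝ → ℂ} (hγ : IsCurveIn Ω a b γ) :
    ENNReal.ofReal (∫ x in ‖b - P‖..‖a - P‖, g x) ≤ kpLength Ω γ := by
  have hne : ∀ t ∈ Icc (0 : ℝ) 1, γ t - P ≠ 0 := fun t ht h =>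
    hP (sub_eq_zero.1 h ▸ hγ.mapsTo ht)
  have hpos : ∀ t ∈ Icc (0 : ℝ) 1, 0 < ‖γ t - P‖ := fun t ht => norm_pos_iff.2 (hne t ht)
  have hcont : ContinuousOn (fun t => ‖γ t - P‖) (Icc 0 1) :=
    (hγ.contDiffOn.continuousOn.sub continuousOn_const).norm
  have hdcont : ContinuousOn (fun t => ‖derivWithin γ (Icc 0 1) t‖) (Icc 0 1) :=
    (hγ.contDiffOn.continuousOn_derivWithin (uniqueDiffOn_Icc one_pos) le_rfl).norm
  set φ : ℝ → ℝ := fun t => g ‖γ t - P‖ * ‖derivWithin γ (Icc 0 1) t‖ with hφ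
  have hφcont : ContinuousOn φ (Icc 0 1) := (hg.comp hcont hpos).mul hdcont
  have hφint : IntegrableOn φ (Icc 0 1) := hφcont.integrableOn_Icc
  have hφ0 : ∀ t ∈ Icc (0 : ℝ) 1, 0 ≤ φ t := fun t ht =>
    mul_nonneg (hg0 _ (hpos t ht)) (norm_nonneg _)
  have h1 : ENNReal.ofReal (∫ t in Icc (0 : ℝ) 1, φ t) ≤ kpLength Ω γ := by
    rw [ofReal_integral_eq_lintegral_ofReal hφint
      ((ae_restrict_iff' measurableSet_Icc).2 (Filter.Eventually.of_forall hφ0))]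
    refine setLIntegral_mono' measurableSet_Icc fun t ht => ENNReal.ofReal_le_ofReal ?_
    exact mul_le_mul_of_nonneg_right (hkp _ (hγ.mapsTo ht)) (norm_nonneg _)
  refine le_trans (ENNReal.ofReal_le_ofReal ?_) h1
  rw [integral_Icc_eq_integral_Ioc, ← intervalIntegral.integral_of_le zero_le_one]
  have hap : 0 < ‖a - P‖ := by simpa [hγ.source] using hpos 0 (by simp)
  have hint : ∀ x y : ℝ, 0 < x → 0 < y → IntervalIntegrable g volume x y := fun x y hx hy =>
    (hg.mono fun z hz => lt_of_lt_of_le (lt_min hx hy) hz.1).intervalIntegrable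
  have hG : ∀ x, 0 < x → HasDerivAt (fun y => ∫ s in ‖a - P‖..y, g s) (g x) x := fun x hx =>
    intervalIntegral.integral_hasDerivAt_right (hint _ _ hap hx)
      (hg.stronglyMeasurableAtFilter isOpen_Ioi x hx) (hg.continuousAt (Ioi_mem_nhds hx))
  have hGc : ContinuousOn (fun y => ∫ s in ‖a - P‖..y, g s) (Ioi 0) := fun x hx =>
    (hG x hx).continuousAt.continuousWithinAt
  have hdγ : ∀ t ∈ Ioo (0 : ℝ) 1, HasDerivAt γ (derivWithin γ (Icc 0 1) t) t := fun t ht =>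
    ((hγ.contDiffOn.differentiableOn one_ne_zero t
      (Ioo_subset_Icc_self ht)).hasDerivWithinAt).hasDerivAt (Icc_mem_nhds ht.1 ht.2)
  have hn : ∀ t ∈ Ioo (0 : ℝ) 1, DifferentiableAt ℝ (fun z : ℂ => ‖z‖) (γ t - P) := fun t ht =>
    (contDiffAt_norm ℝ (hne t (Ioo_subset_Icc_self ht))).differentiableAt one_ne_zero
  have key := intervalIntegral.sub_le_integral_of_hasDeriv_right_of_le
    (g := fun t => -∫ s in ‖a - P‖..‖γ t - P‖, g s) (φ := φ)
    (g' := fun t => -(g ‖γ t - P‖ * fderiv ℝ (fun z : ℂ => ‖z‖) (γ t - P)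
      (derivWithin γ (Icc 0 1) t)))
    zero_le_one (hGc.comp hcont hpos).neg
    (fun t ht => by
      have h := (hn t ht).hasFDerivAt.comp_hasDerivAt t ((hdγ t ht).sub_const P)
      exact ((hG _ (hpos t (Ioo_subset_Icc_self ht))).comp t h).neg.hasDerivWithinAt)
    hφint
    (fun t ht => by
      have h2 : |fderiv ℝ (fun z : ℂ => ‖z‖) (γ t - P) (derivWithin γ (Icc 0 1) t)| ≤
          ‖derivWithin γ (Icc 0 1) t‖ := by
        have := (fderiv ℝ (fun z : ℂ => ‖z‖) (γ t - P)).le_opNorm (derivWithin γ (Icc 0 1) t)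
        rwa [norm_fderiv_norm (hn t ht), one_mul] at this
      rw [← mul_neg]
      exact mul_le_mul_of_nonneg_left ((neg_le_abs _).trans h2)
        (hg0 _ (hpos t (Ioo_subset_Icc_self ht))))
  simp only [hγ.source, hγ.target, intervalIntegral.integral_same] at key
  rw [intervalIntegral.integral_symm]
  linarith

theorem kpEDist_le_of_segment {Ω : Set ℂ} {a u : ℂ} {d A : ℝ} {g : ℝ → ℝ} (hu : ‖u‖ = 1)
    (hd : 0 ≤ d) (hdA : d < A) (hg : ContinuousOn g (Ioi 0)) (hg0 : ∀ x, 0 < x → 0 ≤ g x)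
    (hΩ : ∀ t ∈ Icc 0 d, a + t • u ∈ Ω)
    (hkp : ∀ t ∈ Icc 0 d, kpDensity Ω (a + t • u) ≤ g (A - t)) :
    kpEDist Ω a (a + d • u) ≤ ENNReal.ofReal (∫ x in (A - d)..A, g x) := by
  have hmem : ∀ t ∈ Icc (0 : ℝ) 1, t * d ∈ Icc 0 d := fun t ht =>
    ⟨mul_nonneg ht.1 hd, mul_le_of_le_one_left hd ht.2⟩
  have hder : ∀ t, HasDerivAt (fun t : ℝ => a + (t * d) • u) (d • u) t := fun t => by
    simpa using ((((hasDerivAt_id t).mul_const d).smul_const u).const_add a)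
  have hcurve : IsCurveIn Ω a (a + d • u) (fun t : ℝ => a + (t * d) • u) :=
    { contDiffOn := by fun_prop
      mapsTo := fun t ht => hΩ _ (hmem t ht)
      source := by simp
      target := by simp }
  refine (iInf₂_le _ hcurve).trans ?_
  have hφcont : ContinuousOn (fun t : ℝ => g (A - d * t) * d) (Icc 0 1) := by
    refine (hg.comp (by fun_prop) fun t ht => ?_).mul continuousOn_const
    have := (hmem t ht).2
    simp only [mem_Ioi]; nlinarith
  have hcalc : ∫ x in (A - d)..A, g x = ∫ t in Icc (0 : ℝ) 1, g (A - d * t) * d := by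
    rw [integral_Icc_eq_integral_Ioc, ← intervalIntegral.integral_of_le zero_le_one,
      intervalIntegral.integral_mul_const, mul_comm, intervalIntegral.mul_integral_comp_sub_mul]
    simp
  rw [hcalc, ofReal_integral_eq_lintegral_ofReal hφcont.integrableOn_Icc
      ((ae_restrict_iff' measurableSet_Icc).2 (Filter.Eventually.of_forall fun t ht =>
        mul_nonneg (hg0 _ (by have := (hmem t ht).2; nlinarith)) hd))]
  refine setLIntegral_mono' measurableSet_Icc fun t ht => ENNReal.ofReal_le_ofReal ?_
  rw [(hder t).hasDerivWithinAt.derivWithin (uniqueDiffOn_Icc one_pos t ht), norm_smul, hu,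
    mul_one, Real.norm_of_nonneg hd, mul_comm d t]
  exact mul_le_mul_of_nonneg_right (hkp _ (hmem t ht)) hd

/-- A lower bound for the density that depends only on the distance to `P`, and is attained along
a segment pointing to `P`, determines the distance between the ends of the segment. -/
theorem kpEDist_eq_of_radial {Ω : Set ℂ} {a u : ℂ} {d A : ℝ} {g : ℝ → ℝ} (hu : ‖u‖ = 1)
    (hd : 0 ≤ d) (hdA : d < A) (hg : ContinuousOn g (Ioi 0)) (hg0 : ∀ x, 0 < x → 0 ≤ g x)
    (hP : a + A • u ∉ Ω) (hlow : ∀ z ∈ Ω, g ‖z - (a + A • u)‖ ≤ kpDensity Ω z)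
    (hΩ : ∀ t ∈ Icc 0 d, a + t • u ∈ Ω)
    (hkp : ∀ t ∈ Icc 0 d, kpDensity Ω (a + t • u) ≤ g (A - t)) :
    kpEDist Ω a (a + d • u) = ENNReal.ofReal (∫ x in (A - d)..A, g x) := by
  refine (kpEDist_le_of_segment hu hd hdA hg hg0 hΩ hkp).antisymm
    (le_iInf₂ fun γ hγ => ?_)
  have h := integral_le_kpLength hg hg0 hP hlow hγ
  have e1 : ‖a + d • u - (a + A • u)‖ = A - d := by
    rw [add_sub_add_left_eq_sub, ← sub_smul, norm_smul, hu, mul_one, norm_sub_rev,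
      Real.norm_of_nonneg (by linarith)]
  have e2 : ‖a - (a + A • u)‖ = A := by
    rw [sub_add_cancel_left, norm_neg, norm_smul, hu, mul_one, Real.norm_of_nonneg (by linarith)]
  rwa [e1, e2] at h

/-! ### Disks contained in a stadium -/

theorem hypDiskDensity_nonneg {c z : ℂ} {ρ : ℝ} (hz : z ∈ Metric.ball c ρ) :
    0 ≤ hypDiskDensity c ρ z := by
  have h : dist z c < ρ := hz
  have h0 : 0 ≤ dist z c := dist_nonneg
  exact div_nonneg (by linarith) (by nlinarith)

theorem kpDensity_le {Ω : Set ℂ} {c z : ℂ} {ρ : ℝ} (hz : z ∈ Metric.ball c ρ)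
    (hΩ : Metric.ball c ρ ⊆ Ω) : kpDensity Ω z ≤ hypDiskDensity c ρ z := by
  refine csInf_le ⟨0, ?_⟩ ⟨c, ρ, hz, hΩ, rfl⟩
  rintro l ⟨c', ρ', hz', -, rfl⟩
  exact hypDiskDensity_nonneg hz'

theorem le_kpDensity {Ω : Set ℂ} (hΩ : IsOpen Ω) {z : ℂ} (hz : z ∈ Ω) {m : ℝ}
    (h : ∀ c ρ, z ∈ Metric.ball c ρ → Metric.ball c ρ ⊆ Ω → m ≤ hypDiskDensity c ρ z) :
    m ≤ kpDensity Ω z := by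
  obtain ⟨ε, hε, hb⟩ := Metric.isOpen_iff.1 hΩ z hz
  refine le_csInf ⟨_, z, ε, Metric.mem_ball_self hε, hb, rfl⟩ ?_
  rintro l ⟨c, ρ, hz', hb', rfl⟩
  exact h c ρ hz' hb'

theorem inv_le_hypDiskDensity {c z : ℂ} {ρ M : ℝ} (hz : z ∈ Metric.ball c ρ) (hM : 0 < M)
    (h : ρ ^ 2 - dist z c ^ 2 ≤ ρ * M) : M⁻¹ ≤ hypDiskDensity c ρ z := by
  have h1 : dist z c < ρ := hz
  have h0 : 0 ≤ dist z c := dist_nonneg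
  rw [hypDiskDensity, le_div_iff₀ (by nlinarith), inv_mul_le_iff₀ hM]
  linarith

theorem isOpen_stadium (a b : ℂ) (R r : ℝ) : IsOpen (stadium a b R r) :=
  (Metric.isOpen_ball.union Metric.isOpen_ball).convexHull

theorem inner_le_of_mem_stadium {a b n z : ℂ} {R r m : ℝ} (hn : ‖n‖ = 1)
    (ha : inner ℝ n a + R ≤ m) (hb : inner ℝ n b + r ≤ m) (hz : z ∈ stadium a b R r) :
    inner ℝ n z ≤ m := by
  have hball : ∀ c ρ, inner ℝ n c + ρ ≤ m → Metric.ball c ρ ⊆ {w | inner ℝ n w ≤ m} := by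
    intro c ρ h w hw
    have h1 : inner ℝ n (w - c) ≤ ‖n‖ * ‖w - c‖ := real_inner_le_norm _ _
    rw [inner_sub_right, hn, one_mul] at h1
    have h2 : ‖w - c‖ < ρ := mem_ball_iff_norm.1 hw
    simp only [mem_ofPred_eq]; linarith
  have hconv : Convex ℝ {w : ℂ | inner ℝ n w ≤ m} :=
    convex_halfSpace_le (innerₛₗ ℝ n).isLinear m
  exact convexHull_min (union_subset (hball a R ha) (hball b r hb)) hconv hz

theorem inner_add_radius_le_of_ball_subset_stadium {a b n c : ℂ} {R r m ρ : ℝ} (hn : ‖n‖ = 1)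
    (ha : inner ℝ n a + R ≤ m) (hb : inner ℝ n b + r ≤ m) (hρ : 0 < ρ)
    (h : Metric.ball c ρ ⊆ stadium a b R r) : inner ℝ n c + ρ ≤ m := by
  suffices ρ ≤ m - inner ℝ n c by linarith
  refine le_of_forall_lt_imp_le_of_dense fun t ht => ?_
  rcases lt_or_ge t 0 with h0 | h0
  · have := inner_le_of_mem_stadium hn ha hb (h (Metric.mem_ball_self hρ))
    linarith
  · have hm : c + t • n ∈ Metric.ball c ρ := by
      rw [mem_ball_iff_norm, add_sub_cancel_left, norm_smul, hn, mul_one,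
        Real.norm_of_nonneg h0]
      exact ht
    have := inner_le_of_mem_stadium hn ha hb (h hm)
    rw [inner_add_right, inner_smul_right, real_inner_self_eq_norm_sq, hn] at this
    linarith

theorem ball_subset_stadium {a u : ℂ} {d R r t : ℝ} (hR : 0 < R) (hr : 0 < r)
    (ht : t ∈ Icc (0 : ℝ) 1) :
    Metric.ball (a + (t * d) • u) (R - t * (R - r)) ⊆ stadium a (a + d • u) R r := by
  intro z hz
  set ρ := R - t * (R - r) with hρd
  have hzρ : ‖z - (a + (t * d) • u)‖ < ρ := mem_ball_iff_norm.1 hz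
  have hρ : 0 < ρ := (norm_nonneg _).trans_lt hzρ
  set w : ℂ := ρ⁻¹ • (z - (a + (t * d) • u)) with hw
  have hw1 : ‖w‖ < 1 := by
    rw [hw, norm_smul, norm_inv, Real.norm_of_nonneg hρ.le, inv_mul_lt_iff₀ hρ, mul_one]
    exact hzρ
  have hz' : z = a + (t * d) • u + ρ • w := by
    rw [hw, smul_inv_smul₀ hρ.ne']; abel
  have hmem : ∀ (c : ℂ) (s : ℝ), 0 < s → c + s • w ∈ Metric.ball c s := fun c s hs => by
    rw [mem_ball_iff_norm, add_sub_cancel_left, norm_smul, Real.norm_of_nonneg hs.le]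
    exact mul_lt_of_lt_one_right hs hw1
  -- Points with the same relative position `w` in the two generating disks are interpolated.
  have e : z = (1 - t) • (a + R • w) + t • (a + d • u + r • w) := by
    rw [hz', hρd]; module
  rw [e]
  exact convex_convexHull ℝ (Metric.ball a R ∪ Metric.ball (a + d • u) r)
    (subset_convexHull ℝ _ (Or.inl (hmem a R hR)))
    (subset_convexHull ℝ _ (Or.inr (hmem _ r hr))) (sub_nonneg.2 ht.2) ht.1 (sub_add_cancel 1 t)

/-- The stadium lies in a strip of width `2 * R` parallel to its axis. -/
theorem radius_le_of_ball_subset_stadium {a u c : ℂ} {d R r ρ : ℝ} (hu : ‖u‖ = 1) (hrR : r ≤ R)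
    (hρ : 0 < ρ) (h : Metric.ball c ρ ⊆ stadium a (a + d • u) R r) : ρ ≤ R := by
  set v : ℂ := Complex.I * u with hv
  have hv1 : ‖v‖ = 1 := by simp [hv, hu]
  have huv : inner ℝ v u = 0 := by simp [hv, Complex.inner]; ring
  have h1 := inner_add_radius_le_of_ball_subset_stadium (m := inner ℝ v a + R) hv1 le_rfl
    (by rw [inner_add_right, inner_smul_right, huv]; linarith) hρ h
  have h2 := inner_add_radius_le_of_ball_subset_stadium (n := -v) (m := -inner ℝ v a + R)
    (by rw [norm_neg, hv1]) (by rw [inner_neg_left])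
    (by rw [inner_neg_left, inner_add_right, inner_smul_right, huv]; linarith) hρ h
  rw [inner_neg_left] at h2
  linarith

/-- The sides of the sector have outer normals `σ • u ± κ • v` and meet at `a + A • u`. Adding the
two support inequalities cancels the `v` components. -/
theorem radius_le_sin_mul_norm_of_ball_subset_stadium {a u c : ℂ} {d R r ρ A σ κ : ℝ}
    (hu : ‖u‖ = 1) (hρ : 0 < ρ) (hσ : 0 ≤ σ) (hσκ : σ ^ 2 + κ ^ 2 = 1) (hA : R = σ * A)
    (hd : σ * d ≤ R - r) (h : Metric.ball c ρ ⊆ stadium a (a + d • u) R r) :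
    ρ ≤ σ * ‖c - (a + A • u)‖ := by
  set v : ℂ := Complex.I * u with hv
  have hv1 : ‖v‖ = 1 := by simp [hv, hu]
  have huv : inner ℝ v u = 0 := by simp [hv, Complex.inner]; ring
  have key : ∀ k : ℝ, σ ^ 2 + k ^ 2 = 1 →
      σ * inner ℝ u c + k * inner ℝ v c + ρ ≤ σ * inner ℝ u (a + A • u) + k * inner ℝ v a := by
    intro k hk
    have hn : ‖σ • u + k • v‖ = 1 := by
      rw [← pow_left_inj₀ (norm_nonneg _) zero_le_one two_ne_zero, norm_add_sq_real, norm_smul,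
        norm_smul, hu, hv1, inner_smul_left, inner_smul_right, real_inner_comm, huv]
      simpa using hk
    have e : ∀ z : ℂ, inner ℝ (σ • u + k • v) z = σ * inner ℝ u z + k * inner ℝ v z := fun z => by
      rw [inner_add_left, real_inner_smul_left, real_inner_smul_left]
    have huu : inner ℝ u u = (1 : ℝ) := by rw [real_inner_self_eq_norm_sq, hu, one_pow]
    have := inner_add_radius_le_of_ball_subset_stadium
      (m := σ * inner ℝ u (a + A • u) + k * inner ℝ v a) hn
      (by rw [e, inner_add_right, inner_smul_right, huu]; linarith)
      (by
        rw [e]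
        simp only [inner_add_right, inner_smul_right, huu, huv]
        linarith) hρ h
    rwa [e] at this
  have h1 := key κ hσκ
  have h2 := key (-κ) (by rw [neg_sq, hσκ])
  have h3 : inner ℝ u ((a + A • u) - c) ≤ ‖u‖ * ‖(a + A • u) - c‖ := real_inner_le_norm _ _
  rw [hu, one_mul, norm_sub_rev, inner_sub_right] at h3
  nlinarith [mul_le_mul_of_nonneg_left h3 hσ]

/-! ### Equal radii -/

theorem kpEDist_stadium_of_radius_eq {a u : ℂ} {d R : ℝ} (hu : ‖u‖ = 1) (hd : 0 ≤ d)
    (hR : 0 < R) :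
    kpEDist (stadium a (a + d • u) R R) a (a + d • u) = ENNReal.ofReal (d / R) := by
  have huu : inner ℝ u u = (1 : ℝ) := by rw [real_inner_self_eq_norm_sq, hu, one_pow]
  have hball : ∀ t ∈ Icc 0 d, Metric.ball (a + t • u) R ⊆ stadium a (a + d • u) R R := by
    intro t ht
    rcases hd.eq_or_lt with h0 | h0
    · obtain rfl : t = 0 := le_antisymm (h0 ▸ ht.2) ht.1
      simpa using ball_subset_stadium (a := a) (u := u) (d := d) hR hR (t := 0) (by simp)
    · simpa [div_mul_cancel₀ _ h0.ne'] using ball_subset_stadium (a := a) (u := u) (d := d) hR hR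
        (t := t / d) ⟨div_nonneg ht.1 hd, div_le_one_of_le₀ ht.2 hd⟩
  have h := kpEDist_eq_of_radial (Ω := stadium a (a + d • u) R R) (a := a) (u := u) (d := d)
    -- As `g` is constant, any point of the axis beyond the stadium can serve as `P`.
    (A := d + 2 * R) (g := fun _ => R⁻¹) hu hd (by linarith) continuousOn_const
    (fun _ _ => by positivity)
    (fun hP => by
      have := inner_le_of_mem_stadium (m := inner ℝ u a + d + R) hu (by linarith)
        (by rw [inner_add_right, inner_smul_right, huu]; linarith) hP
      rw [inner_add_right, inner_smul_right, huu] at this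
      linarith)
    (fun z hz => le_kpDensity (isOpen_stadium _ _ _ _) hz fun c ρ hzc hc => by
      have hρ : 0 < ρ := Metric.pos_of_mem_ball hzc
      have := radius_le_of_ball_subset_stadium hu le_rfl hρ hc
      exact inv_le_hypDiskDensity hzc hR (by nlinarith))
    (fun t ht => hball t ht (Metric.mem_ball_self hR))
    (fun t ht => by
      refine (kpDensity_le (Metric.mem_ball_self hR) (hball t ht)).trans_eq ?_
      simp [hypDiskDensity, pow_two, div_eq_mul_inv]
      field_simp)
  rw [h]
  congr 1
  simp [div_eq_mul_inv]

/-- The reciprocal of the Kulkarni-Pinkall density on the axis of a stadium, at distance `x` from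
the apex of the sector of half-angle `θ` that contains the stadium. Here `σ = sin θ`, `κ = cos θ`,
`τ = tan (θ / 2)`, and `A` is the distance from the apex to the center of the large disk. -/
noncomputable def axisRadius (σ κ τ A x : ℝ) : ℝ :=
  if x ≤ κ * A then 2 * τ * x else σ * A - max (A - x) 0 ^ 2 / (σ * A)

/-! ### Optimal disks in the sector -/

section
variable {σ κ τ A : ℝ}

theorem continuous_axisRadius (hσ : 0 < σ) (hA : 0 < A) (hσκ : σ ^ 2 + κ ^ 2 = 1)
    (hκ : 0 ≤ κ) (hτ : τ * σ = 1 - κ) : Continuous (axisRadius σ κ τ A) := by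
  have hκ1 : κ ≤ 1 := by nlinarith
  refine Continuous.if_le (by fun_prop) (by fun_prop) continuous_id continuous_const ?_
  rintro x rfl
  rw [max_eq_left (by nlinarith), eq_sub_iff_add_eq, ← mul_right_inj' (mul_pos hσ hA).ne', mul_add,
    mul_div_cancel₀ _ (mul_pos hσ hA).ne']
  linear_combination 2 * κ * A ^ 2 * hτ - A ^ 2 * hσκ

theorem axisRadius_pos (hσ : 0 < σ) (hA : 0 < A) (hσκ : σ ^ 2 + κ ^ 2 = 1)
    (hκ : 0 ≤ κ) (hτ : τ * σ = 1 - κ) {x : ℝ} (hx : 0 < x) : 0 < axisRadius σ κ τ A x := by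
  have hκ1 : κ < 1 := by nlinarith
  have hτ0 : 0 < τ := pos_of_mul_pos_left (by rw [hτ]; linarith) hσ.le
  unfold axisRadius
  split_ifs with h
  · positivity
  · push Not at h
    have hAσ : 0 < σ * A := mul_pos hσ hA
    rw [sub_pos, div_lt_iff₀ hAσ]
    have h1 : max (A - x) 0 < A * (1 - κ) := max_lt (by linarith) (mul_pos hA (by linarith))
    have h2 : 0 ≤ max (A - x) 0 := le_max_right _ _
    have h3 : (1 - κ) ^ 2 ≤ σ ^ 2 := by nlinarith
    have h4 : max (A - x) 0 ^ 2 < (A * (1 - κ)) ^ 2 := by gcongr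
    nlinarith [mul_le_mul_of_nonneg_left h3 (sq_nonneg A)]

/-- `ρ - e ^ 2 / ρ` increases with `ρ`, so only the largest admissible radius matters. -/
theorem sq_sub_sq_le_mul_of_le {ρ ρ' e M : ℝ} (hρ : 0 < ρ) (h : ρ ≤ ρ')
    (h' : ρ' ^ 2 - e ^ 2 ≤ ρ' * M) : ρ ^ 2 - e ^ 2 ≤ ρ * M := by
  have hρ' : 0 < ρ' := hρ.trans_le h
  refine le_of_mul_le_mul_left ?_ hρ'
  have h1 : ρ * (ρ' ^ 2 - e ^ 2) ≤ ρ * (ρ' * M) := mul_le_mul_of_nonneg_left h' hρ.le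
  have h2 : 0 ≤ (ρ' - ρ) * (ρ * ρ' + e ^ 2) := by
    have := sub_nonneg.2 h; positivity
  nlinarith

theorem sq_sub_sq_le_mul_axisRadius (hσ : 0 < σ) (hA : 0 < A) (hσκ : σ ^ 2 + κ ^ 2 = 1)
    (hκ : 0 ≤ κ) (hτ : τ * σ = 1 - κ) {x s ρ : ℝ} (hρ : 0 < ρ) (h1 : ρ ≤ σ * s)
    (h2 : ρ ≤ σ * A) : ρ ^ 2 - (x - s) ^ 2 ≤ ρ * axisRadius σ κ τ A x := by
  have hs : 0 < s := pos_of_mul_pos_right (hρ.trans_le h1) hσ.le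
  have hAσ : 0 < σ * A := mul_pos hσ hA
  unfold axisRadius
  split_ifs with h
  -- With `ρ = σ * s` the optimum is at `s = x / κ`, hence the square of `κ * s - x`.
  · refine sq_sub_sq_le_mul_of_le hρ h1 ?_
    have : (σ * s) ^ 2 - (x - s) ^ 2 - σ * s * (2 * τ * x) = -(κ * s - x) ^ 2 := by
      linear_combination s ^ 2 * hσκ - 2 * s * x * hτ
    nlinarith [sq_nonneg (κ * s - x)]
  · push Not at h
    rcases le_total x A with hx | hx
    · rw [max_eq_left (by linarith)]
      rcases le_total s A with hsA | hsA
      -- The unconstrained optimum `x / κ` now exceeds `A`, so the best `s ≤ A` is `A` itself, which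
      -- gives the large disk.
      · refine sq_sub_sq_le_mul_of_le hρ h1 ?_
        have e : σ * s * (σ * A - (A - x) ^ 2 / (σ * A)) =
            (s * σ ^ 2 * A ^ 2 - s * (A - x) ^ 2) / A := by field_simp
        rw [e, le_div_iff₀ hA]
        have h3 : κ ^ 2 * A * s ≤ x ^ 2 := by
          have : (κ * A) ^ 2 ≤ x ^ 2 := by gcongr
          nlinarith [mul_le_mul_of_nonneg_left hsA (mul_nonneg (sq_nonneg κ) hA.le)]
        have h4 : 0 ≤ (A - s) * (x ^ 2 - κ ^ 2 * A * s) :=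
          mul_nonneg (by linarith) (by linarith)
        have h5 : κ ^ 2 = 1 - σ ^ 2 := by linarith
        rw [h5] at h4
        nlinarith
      · refine sq_sub_sq_le_mul_of_le hρ h2 ?_
        rw [mul_sub, mul_div_cancel₀ _ hAσ.ne']
        nlinarith
    · rw [max_eq_right (by linarith)]
      simp only [ne_eq, OfNat.ofNat_ne_zero, not_false_eq_true, zero_pow, zero_div, sub_zero]
      nlinarith [sq_nonneg (x - s)]

/-- `κ = 0` covers the case where the stadium is just the large disk: `σ * d` may then be less than
`R - r`, and only the large disk serves as optimal disk. -/
theorem kpEDist_stadium_eq_integral {a u : ℂ} {d R r : ℝ} (hσ : 0 < σ) (hA : 0 < A)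
    (hσκ : σ ^ 2 + κ ^ 2 = 1) (hκ : 0 ≤ κ) (hτ : τ * σ = 1 - κ) (hu : ‖u‖ = 1) (hd : 0 ≤ d)
    (hr : 0 < r) (hrR : r ≤ R) (hAR : R = σ * A) (hdσ : σ * d ≤ R - r)
    (hdσ' : κ ≠ 0 → σ * d = R - r) :
    kpEDist (stadium a (a + d • u) R r) a (a + d • u) =
      ENNReal.ofReal (∫ x in (A - d)..A, (axisRadius σ κ τ A x)⁻¹) := by
  have hR : 0 < R := hr.trans_le hrR
  have hdA : d < A := by
    refine lt_of_mul_lt_mul_left ?_ hσ.le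
    linarith
  have hpos : ∀ x, 0 < x → 0 < axisRadius σ κ τ A x := fun x hx =>
    axisRadius_pos hσ hA hσκ hκ hτ hx
  have hκ1 : κ < 1 := by nlinarith
  have hdisk : ∀ s ∈ Icc 0 d, (s ≠ 0 → σ * d = R - r) →
      Metric.ball (a + s • u) (R - σ * s) ⊆ stadium a (a + d • u) R r := by
    intro s hs hs'
    rcases eq_or_ne s 0 with rfl | h0
    · simpa using ball_subset_stadium (a := a) (u := u) (d := d) hR hr (t := 0) (by simp)
    · have hd0 : d ≠ 0 := by rintro rfl; exact h0 (le_antisymm hs.2 hs.1)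
      have := ball_subset_stadium (a := a) (u := u) (d := d) hR hr
        (t := s / d) ⟨div_nonneg hs.1 hd, div_le_one_of_le₀ hs.2 hd⟩
      rwa [← hs' h0, div_mul_cancel₀ _ hd0,
        show s / d * (σ * d) = σ * s by field_simp] at this
  -- Here `s` is the distance from `a` to the center of the optimal disk: `A - (A - t) / κ` if this
  -- is nonnegative, and `0` otherwise.
  have hopt : ∀ t ∈ Icc 0 d, ∃ s ∈ Icc 0 d, (s ≠ 0 → σ * d = R - r) ∧
      |t - s| < R - σ * s ∧
      (R - σ * s) * axisRadius σ κ τ A (A - t) = (R - σ * s) ^ 2 - (t - s) ^ 2 := by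
    intro t ht
    by_cases h : A - t ≤ κ * A
    · have hκ0 : 0 < κ := by
        rcases hκ.eq_or_lt with h0 | h0
        · rw [← h0] at h; linarith [ht.2]
        · exact h0
      obtain ⟨y, hy⟩ : ∃ y, A - t = κ * y := ⟨(A - t) / κ, by field_simp⟩
      have hy0 : 0 < y := pos_of_mul_pos_right (by rw [← hy]; linarith [ht.2]) hκ
      have hyA : y ≤ A := le_of_mul_le_mul_left (by linarith) hκ0
      have e1 : R - σ * (A - y) = σ * y := by rw [hAR]; ring
      have e2 : t - (A - y) = (1 - κ) * y := by linear_combination -hy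
      refine ⟨A - y, ⟨by linarith, ?_⟩, fun _ => hdσ' hκ0.ne', ?_, ?_⟩
      · nlinarith [ht.2]
      · rw [e1, e2, abs_of_nonneg (mul_nonneg (by linarith) hy0.le)]
        gcongr
        nlinarith
      · rw [e1, e2, axisRadius, if_pos h, hy]
        linear_combination 2 * κ * y ^ 2 * hτ - y ^ 2 * hσκ
    · have h' := h
      push Not at h'
      refine ⟨0, ⟨le_rfl, hd⟩, fun h => (h rfl).elim, ?_, ?_⟩
      · rw [sub_zero, abs_of_nonneg ht.1, mul_zero, sub_zero, hAR]
        nlinarith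
      · rw [axisRadius, if_neg h, max_eq_left (by linarith [ht.1]), mul_zero, sub_zero, sub_zero,
          hAR, mul_sub, mul_div_cancel₀ _ (mul_pos hσ hA).ne']
        ring
  have hdist : ∀ t s : ℝ, dist (a + t • u) (a + s • u) = |t - s| := fun t s => by
    rw [dist_add_left, dist_eq_norm, ← sub_smul, norm_smul, hu, mul_one, Real.norm_eq_abs]
  refine kpEDist_eq_of_radial hu hd hdA
    ((continuous_axisRadius hσ hA hσκ hκ hτ).continuousOn.inv₀ fun x hx => (hpos x hx).ne')
    (fun x hx => (inv_pos.2 (hpos x hx)).le) ?_ ?_ ?_ ?_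
  -- A disk about the apex would have radius at most `σ * 0`.
  · intro hP
    obtain ⟨ε, hε, hb⟩ := Metric.isOpen_iff.1 (isOpen_stadium _ _ _ _) _ hP
    have := radius_le_sin_mul_norm_of_ball_subset_stadium hu hε hσ.le hσκ hAR hdσ hb
    rw [sub_self, norm_zero, mul_zero] at this
    linarith
  · intro z hz
    refine le_kpDensity (isOpen_stadium _ _ _ _) hz fun c ρ hzc hc => ?_
    have hρ : 0 < ρ := Metric.pos_of_mem_ball hzc
    have h1 := radius_le_sin_mul_norm_of_ball_subset_stadium hu hρ hσ.le hσκ hAR hdσ hc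
    have h2 := radius_le_of_ball_subset_stadium hu hrR hρ hc
    have h3 := sq_sub_sq_le_mul_axisRadius hσ hA hσκ hκ hτ (x := ‖z - (a + A • u)‖) hρ h1
      (hAR ▸ h2)
    have h4 : |‖z - (a + A • u)‖ - ‖c - (a + A • u)‖| ≤ dist z c := by
      simpa [dist_eq_norm] using abs_norm_sub_norm_le (z - (a + A • u)) (c - (a + A • u))
    have h5 := sq_le_sq' (abs_le.1 h4).1 (abs_le.1 h4).2
    refine inv_le_hypDiskDensity hzc (pos_of_mul_pos_right (a := ρ) ?_ hρ.le) (by linarith)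
    have : dist z c < ρ := hzc
    nlinarith [dist_nonneg (x := z) (y := c)]
  · intro t ht
    obtain ⟨s, hs, hs', hts, -⟩ := hopt t ht
    exact hdisk s hs hs' (by rw [Metric.mem_ball, hdist]; exact hts)
  · intro t ht
    obtain ⟨s, hs, hs', hts, e⟩ := hopt t ht
    refine (kpDensity_le (by rw [Metric.mem_ball, hdist]; exact hts)
      (hdisk s hs hs')).trans_eq ?_
    have hx : 0 < A - t := by linarith [ht.2]
    have hρ : 0 < R - σ * s := (abs_nonneg _).trans_lt hts
    rw [hypDiskDensity, hdist, sq_abs, ← e, div_mul_cancel_left₀ hρ.ne']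

/-! ### Evaluation of the integral -/

/-- On this range the integrand is the hyperbolic density of the large disk along a radius. -/
theorem integral_inv_axisRadius_of_le (hσ : 0 < σ) (hA : 0 < A) (hσκ : σ ^ 2 + κ ^ 2 = 1)
    (hκ : 0 ≤ κ) (hτ : τ * σ = 1 - κ) {d : ℝ} (hd : 0 ≤ d) (hdA : d < A) (h : d ≤ A * (1 - κ)) :
    ∫ x in (A - d)..A, (axisRadius σ κ τ A x)⁻¹ =
      1 / 2 * Real.log ((σ * A + d) / (σ * A - d)) := by
  have hκ1 : κ < 1 := by nlinarith
  have hdσ : d < σ * A := by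
    rcases hκ.eq_or_lt with h0 | h0
    · have : σ = 1 := by nlinarith
      rw [this]; linarith
    · nlinarith
  have hsub : uIcc (A - d) A = Icc (A - d) A := uIcc_of_le (by linarith)
  have hderiv : ∀ x ∈ uIcc (A - d) A,
      HasDerivAt (fun x => 1 / 2 * (Real.log (σ * A - (A - x)) - Real.log (σ * A + (A - x))))
        (axisRadius σ κ τ A x)⁻¹ x := by
    intro x hx
    rw [hsub] at hx
    have e : axisRadius σ κ τ A x = σ * A - (A - x) ^ 2 / (σ * A) := by
      have hA' : 0 < σ * A := mul_pos hσ hA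
      rw [axisRadius, max_eq_left (by linarith [hx.2])]
      split_ifs with h'
      · have : x = κ * A := by linarith [hx.1]
        rw [this, eq_sub_iff_add_eq, ← mul_right_inj' hA'.ne', mul_add,
          mul_div_cancel₀ _ hA'.ne']
        linear_combination 2 * κ * A ^ 2 * hτ - A ^ 2 * hσκ
      · rfl
    have p1 : 0 < σ * A - (A - x) := by linarith [hx.1]
    have p2 : 0 < σ * A + (A - x) := by nlinarith [hx.2]
    have hid : HasDerivAt (fun x : ℝ => A - x) (-1) x := (hasDerivAt_id x).const_sub A
    have := ((((hid.const_sub (σ * A)).log p1.ne').sub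
      ((hid.const_add (σ * A)).log p2.ne')).const_mul (1 / 2 : ℝ))
    refine this.congr_deriv ?_
    have p3 : σ * A - (A - x) ^ 2 / (σ * A) =
        (σ * A - (A - x)) * (σ * A + (A - x)) / (σ * A) := by
      field_simp; ring
    rw [e, p3]
    field_simp
    ring
  rw [intervalIntegral.integral_eq_sub_of_hasDerivAt hderiv
    (((continuous_axisRadius hσ hA hσκ hκ hτ).continuousOn.inv₀ fun x hx => by
      rw [hsub] at hx
      exact (axisRadius_pos hσ hA hσκ hκ hτ (by linarith [hx.1])).ne').intervalIntegrable),
    Real.log_div (by linarith) (by linarith)]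
  simp
  ring

theorem integral_inv_axisRadius_of_ge (hσ : 0 < σ) (hA : 0 < A) (hσκ : σ ^ 2 + κ ^ 2 = 1)
    (hκ : 0 ≤ κ) (hτ : τ * σ = 1 - κ) {d : ℝ} (hdA : d < A) (h : A * (1 - κ) < d) :
    ∫ x in (A - d)..A, (axisRadius σ κ τ A x)⁻¹ =
      1 / 2 * (τ⁻¹ * Real.log (κ * A / (A - d)) + Real.log ((1 + τ) / (1 - τ))) := by
  have hκ1 : κ < 1 := by nlinarith
  have hκ0 : 0 < κ := by nlinarith
  have hint : ∀ x y, 0 < x → 0 < y →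
      IntervalIntegrable (fun x => (axisRadius σ κ τ A x)⁻¹) volume x y := fun x y hx hy =>
    ((continuous_axisRadius hσ hA hσκ hκ hτ).continuousOn.inv₀ fun z hz =>
      (axisRadius_pos hσ hA hσκ hκ hτ ((lt_min hx hy).trans_le hz.1)).ne').intervalIntegrable
  -- At `x = κ * A` the optimal disk changes from a smaller inscribed one to the large disk.
  rw [← intervalIntegral.integral_add_adjacent_intervals (b := κ * A)
    (hint _ _ (by linarith) (by positivity)) (hint _ _ (by positivity) hA)]
  have h2 := integral_inv_axisRadius_of_le hσ hA hσκ hκ hτ (d := A * (1 - κ))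
    (mul_nonneg hA.le (by linarith)) (by nlinarith) le_rfl
  rw [show A - A * (1 - κ) = κ * A by ring, ← hτ] at h2
  have h1 : ∫ x in (A - d)..(κ * A), (axisRadius σ κ τ A x)⁻¹ =
      ∫ x in (A - d)..(κ * A), (2 * τ)⁻¹ * x⁻¹ := by
    refine intervalIntegral.integral_congr fun x hx => ?_
    rw [uIcc_of_le (by linarith)] at hx
    simp only [axisRadius, if_pos hx.2, mul_inv]
  rw [h1, h2, intervalIntegral.integral_const_mul, integral_inv_of_pos (by linarith) (by positivity)]
  rw [show σ * A + A * (τ * σ) = σ * A * (1 + τ) by ring,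
    show σ * A - A * (τ * σ) = σ * A * (1 - τ) by ring,
    mul_div_mul_left _ _ (mul_pos hσ hA).ne']
  rw [mul_inv]; ring

end

/-! ### The distance between the centers -/

theorem mainTheorem3 (a b : ℂ) (R r d θ : ℝ) (hr : 0 < r) (hrR : r ≤ R) (hd : dist a b = d)
    (hθ : θ = stadiumAngle R r d) :
    kpEDist (stadium a b R r) a b ≠ ⊤ ∧
    (r = R → kpDist (stadium a b R r) a b = d / r) ∧
    (r < R → d ≤ R * Real.tan (θ / 2) →
      kpDist (stadium a b R r) a b = 1 / 2 * Real.log ((R + d) / (R - d))) ∧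
    (r < R → R * Real.tan (θ / 2) < d →
      kpDist (stadium a b R r) a b =
        1 / 2 * (Real.cot (θ / 2) * Real.log (R / r * Real.cos θ) +
          Real.log ((1 + Real.tan (θ / 2)) / (1 - Real.tan (θ / 2))))) := by
  have hd0 : 0 ≤ d := hd ▸ dist_nonneg
  have hR : 0 < R := hr.trans_le hrR
  obtain ⟨u, hu, rfl⟩ : ∃ u : ℂ, ‖u‖ = 1 ∧ b = a + d • u := by
    rcases eq_or_ne a b with rfl | hab
    · exact ⟨1, norm_one, by simp [← hd]⟩
    · have hd1 : d ≠ 0 := hd ▸ dist_ne_zero.2 hab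
      refine ⟨d⁻¹ • (b - a), ?_, by rw [smul_inv_smul₀ hd1]; abel⟩
      rw [norm_smul, norm_inv, Real.norm_of_nonneg hd0, ← dist_eq_norm, dist_comm, hd,
        inv_mul_cancel₀ hd1]
  rcases hrR.eq_or_lt with rfl | hlt
  · have h := kpEDist_stadium_of_radius_eq (a := a) hu hd0 hr
    refine ⟨h ▸ ENNReal.ofReal_ne_top, fun _ => ?_, fun h => (lt_irrefl _ h).elim,
      fun h => (lt_irrefl _ h).elim⟩
    rw [kpDist, h, ENNReal.toReal_ofReal (by positivity)]
  have hpi := Real.pi_pos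
  have hθ' : 0 < θ ∧ θ ≤ Real.pi / 2 ∧ Real.sin θ * d ≤ R - r ∧
      (Real.cos θ ≠ 0 → Real.sin θ * d = R - r) := by
    rw [hθ, stadiumAngle]
    split_ifs with h
    · have hd1 : 0 < d := by linarith
      have hs : Real.sin (Real.arcsin ((R - r) / d)) = (R - r) / d :=
        Real.sin_arcsin (by have : 0 ≤ (R - r) / d := div_nonneg (by linarith) hd0
                            linarith) (div_le_one_of_le₀ h hd0)
      have he : Real.sin (Real.arcsin ((R - r) / d)) * d = R - r := by
        rw [hs, div_mul_cancel₀ _ hd1.ne']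
      exact ⟨Real.arcsin_pos.2 (div_pos (by linarith) hd1), Real.arcsin_le_pi_div_two _, he.le,
        fun _ => he⟩
    · push Not at h
      exact ⟨by positivity, le_rfl, by rw [Real.sin_pi_div_two]; linarith,
        fun h => (h Real.cos_pi_div_two).elim⟩
  obtain ⟨hθ0, hθ1, hdσ, hdσ'⟩ := hθ'
  clear hθ
  have hσ : 0 < Real.sin θ := Real.sin_pos_of_pos_of_lt_pi hθ0 (by linarith)
  have hκ : 0 ≤ Real.cos θ := Real.cos_nonneg_of_neg_pi_div_two_le_of_le (by linarith) hθ1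
  have hσκ := Real.sin_sq_add_cos_sq θ
  have hch : 0 < Real.cos (θ / 2) := Real.cos_pos_of_mem_Ioo ⟨by linarith, by linarith⟩
  have hτ : Real.tan (θ / 2) * Real.sin θ = 1 - Real.cos θ := by
    have h1 : Real.sin θ = 2 * Real.sin (θ / 2) * Real.cos (θ / 2) := by
      rw [← Real.sin_two_mul]; ring_nf
    have h2 : Real.cos θ = 1 - 2 * Real.sin (θ / 2) ^ 2 := by
      rw [← Real.cos_two_mul_eq_one_sub]; ring_nf
    rw [Real.tan_eq_sin_div_cos, h1, h2]
    field_simp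
    ring
  have hcot : Real.cot (θ / 2) = (Real.tan (θ / 2))⁻¹ := by
    rw [Real.cot_eq_cos_div_sin, Real.tan_eq_sin_div_cos, inv_div]
  obtain ⟨A, hAR⟩ : ∃ A, R = Real.sin θ * A := ⟨R / Real.sin θ, by field_simp⟩
  have hA : 0 < A := pos_of_mul_pos_right (hAR ▸ hR) hσ.le
  have hdA : d < A := lt_of_mul_lt_mul_left (by linarith) hσ.le
  -- The threshold for `d` is the distance from `a` at which the optimal disk changes.
  have hRτ : R * Real.tan (θ / 2) = A * (1 - Real.cos θ) := by rw [hAR, ← hτ]; ring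
  have h := kpEDist_stadium_eq_integral (a := a) hσ hA hσκ hκ hτ hu hd0 hr hrR hAR hdσ hdσ'
  have hdist : kpDist (stadium a (a + d • u) R r) a (a + d • u) =
      ∫ x in (A - d)..A, (axisRadius (Real.sin θ) (Real.cos θ) (Real.tan (θ / 2)) A x)⁻¹ := by
    rw [kpDist, h, ENNReal.toReal_ofReal]
    exact intervalIntegral.integral_nonneg (by linarith) fun x hx =>
      (inv_pos.2 (axisRadius_pos hσ hA hσκ hκ hτ (by linarith [hx.1]))).le
  refine ⟨h ▸ ENNReal.ofReal_ne_top, fun h => (hlt.ne h).elim, fun _ hle => ?_, fun _ hgt => ?_⟩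
  · rw [hdist, integral_inv_axisRadius_of_le hσ hA hσκ hκ hτ hd0 hdA (hRτ ▸ hle), ← hAR]
  · rw [hRτ] at hgt
    have hκ0 : Real.cos θ ≠ 0 := by
      intro h0; rw [h0] at hgt; linarith
    have hrA : r = Real.sin θ * (A - d) := by linarith [hdσ' hκ0]
    rw [hdist, integral_inv_axisRadius_of_ge hσ hA hσκ hκ hτ hdA hgt, hcot, hrA, hAR,
      mul_div_mul_left _ _ hσ.ne',
      div_mul_eq_mul_div A, mul_comm A]
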